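/- **Setting.** Let $A,D\in\mathbb R^{n\times n}$ be symmetric, $A\neq 0$, $b,e\in\mathbb R^n$, $c_1,c_2\in\mathbb R$, and consider $$\text{(IP)}\quad \inf\ f(x)=\tfrac12x^TDx+e^Tx\quad\text{s.t.}\quad c_1\le h(x)=\tfrac12x^TAx+b^Tx\le c_2 ,$$ assumed feasible. Let $E=\begin{pmatrix}0&1\\1&0\end{pmatrix}$ and $J(\zeta,2)=\begin{pmatrix}\zeta&1\\0&\zeta\end{pmatrix}$. Assume that (IP) satisfies the necessary conditions for boundedness, i.e. that an invertible affine change of variables $x=Su+p$ brings it into the canonical form (the case $S=I$, $p=0$ being a problem given in canonical form) $$S^TAS=\mathrm{diag}(\alpha_1,\dots,\alpha_l,\underbrace{E,\dots,E}_{k}),\qquad S^TDS=\mathrm{diag}(\delta_1,\dots,\delta_l,EJ(\zeta_1,2),\dots,EJ(\zeta_k,2)),\qquad n=l+2k,$$ with new linear coefficients $\hat b=S^T(Ap+b)$ and $\hat e=S^T(Dp+e)$ satisfying $\hat b_i=0$ for $i>l$ and $\hat e_{l+2j-1}=0$ for $j=1,\dots,k$. Put $c_0=-\sum_{j=1}^k\frac12\hat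 e_{l+2j}^2$ and consider the SOCP $$\text{(IP}_1)\quad \inf\ \sum_{i=1}^l(\delta_iy_i+\hat e_ix_i)+\sum_{j=1}^k\zeta_jz_j+c_0+f(p)$$ $$\text{s.t.}\quad c_1-h(p)\le\sum_{i=1}^l(\alpha_iy_i+\hat b_ix_i)+\sum_{j=1}^kz_j\le c_2-h(p),\qquad \tfrac12x_i^2-y_i\le0\ (i=1,\dots,l),\qquad x,y\in\mathbb R^l,\ z\in\mathbb R^k.$$ Call a point of (IP$_1$) tight if $\frac12x_i^2=y_i$ for all $i$, and call a block index $j$ critical for it if $\hat e_{l+2j}=0$ and $z_j\ne0$. Optimal values are infima in $[-\infty,\infty]$. **Theorem.** 1. (IP) and (IP$_1$) have the same optimal value. 2. If (IP$_1$) has an optimal solution, it has a tight one; more precisely, for every optimal $(x^*,y^*,z^*)$ there is a tight optimal $(\bar x,\bar y,\bar z)$ with $\bar z=z^*$. 3. Let $(\bar x,\bar y,\bar z)$ be a tight optimal solution of (IP$_1$). For $M>0$ let $\tilde x=Su+p$ with $u_i=\bar x_i$ for $i\le l$ and, for $j=1,\dots,k$, $$u_{l+2j}=\begin{cases}1/M&\text{if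 }j\text{ is critical},\\-\hat e_{l+2j}&\text{otherwise},\end{cases}\qquad u_{l+2j-1}=\bar z_j/u_{l+2j}\quad(\text{read as }0\text{ if }\bar z_j=u_{l+2j}=0).$$ If no $j$ is critical, then $\tilde x$ is an optimal solution of (IP) for every $M>0$. In all cases, for every $\epsilon>0$ there is $M_0>0$ such that for all $M\ge M_0$ the point $\tilde x$ is feasible for (IP) and $f(\tilde x)-v(\mathrm{IP})<\epsilon$; in particular it is $\epsilon$-optimal. 4. Suppose (IP) is bounded from below. Then (IP$_1$) has a tight optimal solution, and the optimal value of (IP) is unattainable if and only if every tight optimal solution $(\bar x,\bar y,\bar z)$ of (IP$_1$) has a critical block, i.e. some $j$ with $\hat e_{l+2j}=0$ and $\bar z_j\neq0$. 5. If $\zeta_i\ne\zeta_j$ for some $i,j\in\{1,\dots,k\}$, then (IP) is unbounded from below. -/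

import Mathlib

open Matrix

noncomputable section

namespace GTRS

/-- The optimal value `inf {f x | x ∈ X}` as an extended real number
(`⊥` exactly when `f` is unbounded from below on `X`). -/
def optVal {V : Type*} (X : Set V) (f : V → ℝ) : EReal := ⨅ x ∈ X, (f x : EReal)

/-- `x` is an optimal solution of `min {f x | x ∈ X}`. -/
def IsOptimal {V : Type*} (X : Set V) (f : V → ℝ) (x : V) : Prop :=
  x ∈ X ∧ ∀ x' ∈ X, f x ≤ f x'

/-- `x` is an `ε`-optimal solution of `min {f x | x ∈ X}`: it is feasible and exceeds the
optimal value by at most `ε`. -/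
def IsEpsOptimal {V : Type*} (X : Set V) (f : V → ℝ) (ε : ℝ) (x : V) : Prop :=
  x ∈ X ∧ (f x : EReal) ≤ optVal X f + (ε : EReal)

/-- The quadratic function `½ xᵀ Q x + qᵀ x`. -/
def quad {n : ℕ} (Q : Matrix (Fin n) (Fin n) ℝ) (q : Fin n → ℝ) (x : Fin n → ℝ) : ℝ :=
  1 / 2 * (x ⬝ᵥ Q *ᵥ x) + q ⬝ᵥ x

/-- The data of the interval constrained problem (IP):
minimize `½ xᵀ D x + eᵀ x` subject to `c₁ ≤ ½ xᵀ A x + bᵀ x ≤ c₂`. -/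
structure IP (n : ℕ) where
  D : Matrix (Fin n) (Fin n) ℝ
  A : Matrix (Fin n) (Fin n) ℝ
  e : Fin n → ℝ
  b : Fin n → ℝ
  c₁ : ℝ
  c₂ : ℝ

/-- Objective function of (IP). -/
def IP.obj {n : ℕ} (P : IP n) : (Fin n → ℝ) → ℝ := quad P.D P.e

/-- Constraint function of (IP). -/
def IP.con {n : ℕ} (P : IP n) : (Fin n → ℝ) → ℝ := quad P.A P.b

/-- Feasible set of (IP). -/
def IP.feasible {n : ℕ} (P : IP n) : Set (Fin n → ℝ) :=
  {x | P.c₁ ≤ P.con x ∧ P.con x ≤ P.c₂}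

/-- Labels of the coordinates in the canonical form: `l` coordinates of `1 × 1` blocks, and for
each of the `k` blocks of size `2 × 2` a first coordinate `inr (0, j)` and a second coordinate
`inr (1, j)`. -/
abbrev Idx (l k : ℕ) : Type := Fin l ⊕ (Fin 2 × Fin k)

/-- The `2 × 2` anti-diagonal matrix. -/
def E₂ : Matrix (Fin 2) (Fin 2) ℝ := !![0, 1; 1, 0]

/-- The `2 × 2` Jordan block with real eigenvalue `ζ`. -/
def J₂ (ζ : ℝ) : Matrix (Fin 2) (Fin 2) ℝ := !![ζ, 1; 0, ζ]

/-- `diag (α₁, …, α_l, E, …, E)` with `k` blocks `E` of size `2 × 2`. -/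
def canonA {l : ℕ} (k : ℕ) (α : Fin l → ℝ) : Matrix (Idx l k) (Idx l k) ℝ :=
  Matrix.fromBlocks (Matrix.diagonal α) 0 0 (Matrix.blockDiagonal fun _ : Fin k => E₂)

/-- `diag (δ₁, …, δ_l, E J(ζ₁, 2), …, E J(ζ_k, 2))`. -/
def canonD {l k : ℕ} (δ : Fin l → ℝ) (ζ : Fin k → ℝ) : Matrix (Idx l k) (Idx l k) ℝ :=
  Matrix.fromBlocks (Matrix.diagonal δ) 0 0 (Matrix.blockDiagonal fun j : Fin k => E₂ * J₂ (ζ j))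

/-- The data of the second order cone program (IP₁). For the `1 × 1` blocks, `α` and `δ` are the
diagonal entries and `β` and `η` are the linear coefficients of constraint and objective; for the
`2 × 2` blocks, `ζ` are the eigenvalues and `θ` are the linear coefficients of the objective at
the second coordinate of the block. `const` is an additive constant of the objective. -/
structure SOCP (l k : ℕ) where
  α : Fin l → ℝ
  δ : Fin l → ℝ
  β : Fin l → ℝ
  η : Fin l → ℝ
  ζ : Fin k → ℝ
  θ : Fin k → ℝ
  c₁ : ℝ
  c₂ : ℝ
  const : ℝ

/-- The variables `x, y ∈ ℝˡ`, `z ∈ ℝᵏ` of (IP₁). -/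
@[ext] structure SOCPVar (l k : ℕ) where
  x : Fin l → ℝ
  y : Fin l → ℝ
  z : Fin k → ℝ

/-- The linear constraint function `h̄` of (IP₁). -/
def SOCP.hbar {l k : ℕ} (Q : SOCP l k) (w : SOCPVar l k) : ℝ :=
  ∑ i, (Q.α i * w.y i + Q.β i * w.x i) + ∑ j, w.z j

/-- The constant `c₀ = - ∑ ½ θ_j²`. -/
def SOCP.c₀ {l k : ℕ} (Q : SOCP l k) : ℝ := -∑ j, 1 / 2 * Q.θ j ^ 2

/-- The linear objective function of (IP₁). -/
def SOCP.obj {l k : ℕ} (Q : SOCP l k) (w : SOCPVar l k) : ℝ :=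
  ∑ i, (Q.δ i * w.y i + Q.η i * w.x i) + ∑ j, Q.ζ j * w.z j + Q.c₀ + Q.const

/-- The feasible set of (IP₁). -/
def SOCP.feasible {l k : ℕ} (Q : SOCP l k) : Set (SOCPVar l k) :=
  {w | Q.c₁ ≤ Q.hbar w ∧ Q.hbar w ≤ Q.c₂ ∧ ∀ i, 1 / 2 * w.x i ^ 2 - w.y i ≤ 0}

/-- All the cone constraints hold with equality. -/
def SOCPVar.Tight {l k : ℕ} (w : SOCPVar l k) : Prop := ∀ i, 1 / 2 * w.x i ^ 2 = w.y i

/-- The invertible affine substitution `x = S u + p` brings (IP) into the canonical form to which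
the necessary conditions for boundedness reduce it:
`A` and `D` become `diag (α, E, …, E)` and `diag (δ, E J(ζ₁, 2), …, E J(ζ_k, 2))` (only real
eigenvalues, blocks of size at most two, sign `+1` on the blocks of size two), the linear part of
the constraint vanishes on the `2 × 2` blocks, and the linear part of the objective vanishes on
the first coordinate of each `2 × 2` block. The values of the two functions at `p` are moved to
the bounds and to the additive constant; for a problem given in canonical form, `S` is the
identity and `p = 0`. -/
structure IsCanonicalForm {n l k : ℕ} (P : IP n) (S : Matrix (Fin n) (Idx l k) ℝ)
    (p : Fin n → ℝ) (Q : SOCP l k) : Prop where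
  invertible : ∃ T : Matrix (Idx l k) (Fin n) ℝ, S * T = 1 ∧ T * S = 1
  matA : Sᵀ * P.A * S = canonA k Q.α
  matD : Sᵀ * P.D * S = canonD Q.δ Q.ζ
  linA : Sᵀ *ᵥ (P.A *ᵥ p + P.b) = Sum.elim Q.β 0
  linD : Sᵀ *ᵥ (P.D *ᵥ p + P.e) = Sum.elim Q.η fun q => if q.1 = 1 then Q.θ q.2 else 0
  lower : Q.c₁ = P.c₁ - P.con p
  upper : Q.c₂ = P.c₂ - P.con p
  const : Q.const = P.obj p

/-- A `2 × 2` block `j` at which the point `w` of (IP₁) is not realized exactly: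
`θ_j = 0` and `z_j ≠ 0`. -/
def SOCP.Critical {l k : ℕ} (Q : SOCP l k) (w : SOCPVar l k) (j : Fin k) : Prop :=
  Q.θ j = 0 ∧ w.z j ≠ 0

open Classical in
/-- Second coordinate of the `j`-th `2 × 2` block of the recovered point. -/
def SOCP.second {l k : ℕ} (Q : SOCP l k) (M : ℝ) (w : SOCPVar l k) (j : Fin k) : ℝ :=
  if Q.Critical w j then 1 / M else -Q.θ j

/-- The point recovered from `w`, in canonical coordinates: `x` on the `1 × 1` blocks, and
`(z_j / s_j, s_j)` on the `j`-th `2 × 2` block, where `s_j` is `Q.second M w j`. If `s_j = 0` (then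
also `θ_j = z_j = 0`), the quotient is understood as `0`. -/
def SOCP.recover {l k : ℕ} (Q : SOCP l k) (M : ℝ) (w : SOCPVar l k) : Idx l k → ℝ :=
  Sum.elim w.x fun q =>
    if q.1 = 1 then Q.second M w q.2
    else if Q.second M w q.2 = 0 then 0 else w.z q.2 / Q.second M w q.2

end GTRS

end

/-! In canonical coordinates put `z_j` for the product of the two coordinates of block `j` and `y_i`
for `½ x_i²`. Constraint and objective become linear up to one remainder: completing the square in
each block leaves `∑ ½ (u_j + θ_j)²`, where `u_j` is the second coordinate
(`IsCanonicalForm.obj_affine`). This nonnegative remainder gives one inequality between the optimal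
values. Conversely, a tight point is the image of any choice `(z_j / s_j, s_j)`; the remainder
vanishes for `s_j = -θ_j`, except that `θ_j = 0 ≠ z_j` forces `s_j = 1 / M`, at a cost tending to 0.
Attainment in (IP) therefore fails exactly when critical blocks are unavoidable. Relaxing to the
cone costs nothing: `exists_tight_coordinate` slides each `(x_i, y_i)` to the parabola unless `α_i =
0` and `δ_i < 0`, and in that case (IP) is itself unbounded because `A ≠ 0` (`exists_tight_obj_le`).
A bounded (IP₁) is solvable by Lagrangian duality (`exists_isOptimal`): either some direction moves
the constraint value freely at constant Lagrangian, or some multiplier makes the Lagrangian coercive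
in all variables that matter. -/

namespace GTRS

/-! ### Infima in the extended reals -/

section OptVal

variable {V : Type*} {X : Set V} {f : V → ℝ}

lemma optVal_le {x : V} (hx : x ∈ X) : optVal X f ≤ (f x : EReal) :=
  iInf₂_le x hx

lemma IsOptimal.optVal_eq {x : V} (hx : IsOptimal X f x) : optVal X f = (f x : EReal) :=
  le_antisymm (optVal_le hx.1) (le_iInf₂ fun y hy => EReal.coe_le_coe_iff.2 (hx.2 y hy))

lemma isOptimal_of_le_optVal {x : V} (hx : x ∈ X) (h : (f x : EReal) ≤ optVal X f) :
    IsOptimal X f x :=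
  ⟨hx, fun _ hy => EReal.coe_le_coe_iff.1 (h.trans (optVal_le hy))⟩

lemma optVal_eq_bot_of_forall (h : ∀ C : ℝ, ∃ x ∈ X, f x ≤ C) : optVal X f = ⊥ := by
  rw [EReal.eq_bot_iff_forall_lt]
  intro C
  obtain ⟨x, hx, hC⟩ := h (C - 1)
  exact (optVal_le hx).trans_lt (EReal.coe_lt_coe_iff.2 (by linarith))

lemma le_of_le_optVal {m : ℝ} (h : (m : EReal) ≤ optVal X f) {x : V} (hx : x ∈ X) : m ≤ f x :=
  EReal.coe_le_coe_iff.1 (h.trans (optVal_le hx))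

lemma le_optVal {m : ℝ} (h : ∀ x ∈ X, m ≤ f x) : (m : EReal) ≤ optVal X f :=
  le_iInf₂ fun x hx => EReal.coe_le_coe_iff.2 (h x hx)

end OptVal

/-! ### One-variable estimates and sliding to the parabola -/

section RealAux

lemma exists_quartic_le {a : ℝ} (ha : a < 0) (b c d e C : ℝ) :
    ∃ t : ℝ, a * t ^ 4 + b * t ^ 3 + c * t ^ 2 + d * t + e ≤ C := by
  set s := |b| + |c| + |d| + |e| + |C| with hs
  have hs0 : 0 ≤ s := by positivity
  obtain ⟨t, ht1, ht⟩ : ∃ t : ℝ, 1 ≤ t ∧ a * t ≤ -s := by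
    refine ⟨1 + s / -a, ?_, ?_⟩
    · have : 0 ≤ s / -a := div_nonneg hs0 (by linarith)
      linarith
    · have : a * (1 + s / -a) = a - s := by
        have := ha.ne
        field_simp
        ring
      linarith
  refine ⟨t, ?_⟩
  have h0 : 0 ≤ t := by linarith
  have h2 : t ^ 2 ≤ t ^ 3 := pow_le_pow_right₀ ht1 (by norm_num)
  have h1 : t ≤ t ^ 3 := by simpa using pow_le_pow_right₀ ht1 (show 1 ≤ 3 by norm_num)
  have h3 : 1 ≤ t ^ 3 := one_le_pow₀ ht1
  have e4 : a * t ^ 4 ≤ -s * t ^ 3 := by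
    have := mul_le_mul_of_nonneg_right ht (by positivity : 0 ≤ t ^ 3)
    nlinarith
  have eb : b * t ^ 3 ≤ |b| * t ^ 3 := by gcongr; exact le_abs_self b
  have ec : c * t ^ 2 ≤ |c| * t ^ 3 :=
    mul_le_mul (le_abs_self c) h2 (by positivity) (abs_nonneg c)
  have ed : d * t ≤ |d| * t ^ 3 := mul_le_mul (le_abs_self d) h1 h0 (abs_nonneg d)
  have ee : e ≤ |e| * t ^ 3 := by
    nlinarith [le_abs_self e, mul_le_mul_of_nonneg_left h3 (abs_nonneg e)]
  have eC : -C ≤ |C| * t ^ 3 := by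
    nlinarith [neg_abs_le C, mul_le_mul_of_nonneg_left h3 (abs_nonneg C)]
  have : -s * t ^ 3 = -(|b| * t ^ 3) - |c| * t ^ 3 - |d| * t ^ 3 - |e| * t ^ 3 - |C| * t ^ 3 := by
    rw [hs]; ring
  linarith

lemma exists_linear_eq {a : ℝ} (ha : a ≠ 0) (b C : ℝ) : ∃ t : ℝ, b + a * t = C :=
  ⟨(C - b) / a, by field_simp; ring⟩

lemma sum_eq_sum_add_of_forall_ne {ι : Type*} [Fintype ι] {g g' : ι → ℝ} (i : ι)
    (h : ∀ j, j ≠ i → g' j = g j) : ∑ j, g' j = ∑ j, g j + (g' i - g i) := by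
  classical
  rw [← Finset.add_sum_erase _ g (Finset.mem_univ i), ← Finset.add_sum_erase _ g' (Finset.mem_univ i),
    Finset.sum_congr rfl fun j hj => h j (Finset.ne_of_mem_erase hj)]
  ring

/-- Inside the epigraph of `x ↦ ½ x²` one can move to the boundary without changing the linear
function `α y + β x` and without increasing `δ y + η x`. -/
lemma exists_tight_coordinate {α β δ η x y : ℝ} (hδ : α = 0 → 0 ≤ δ) (hxy : 1 / 2 * x ^ 2 - y ≤ 0) :
    ∃ x' : ℝ, α * (1 / 2 * x' ^ 2) + β * x' = α * y + β * x ∧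
      δ * (1 / 2 * x' ^ 2) + η * x' ≤ δ * y + η * x := by
  rcases eq_or_ne α 0 with hα | hα
  · refine ⟨x, by simp [hα], ?_⟩
    nlinarith [mul_nonneg (hδ hα) (by linarith : 0 ≤ y - 1 / 2 * x ^ 2)]
  -- `m` is the slope of the lines on which the constraint is constant. Such a line through a point
  -- of the epigraph meets the parabola at `x = m - r` and `x = m + r`, on either side of the point.
  -- Along it the objective has slope `δ m + η`, whose sign selects the endpoint.
  · obtain ⟨m, hm⟩ : ∃ m, β = -(α * m) := ⟨-β / α, by field_simp⟩
    set r := Real.sqrt ((x - m) ^ 2 + 2 * (y - 1 / 2 * x ^ 2)) with hr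
    have hr2 : r ^ 2 = (x - m) ^ 2 + 2 * (y - 1 / 2 * x ^ 2) :=
      Real.sq_sqrt (by nlinarith [sq_nonneg (x - m)])
    have hle : |x - m| ≤ r := Real.abs_le_sqrt (by linarith)
    have h1 := (abs_le.1 hle).1
    have h2 := (abs_le.1 hle).2
    have key : ∀ s, (s + (x - m)) ^ 2 = r ^ 2 → 1 / 2 * (x + s) ^ 2 = y + m * s := by
      intro s hs; nlinarith
    rcases le_total 0 (δ * m + η) with hc | hc
    · refine ⟨x + (-(x - m) - r), ?_, ?_⟩
      · rw [key _ (by ring), hm]; ring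
      · rw [key _ (by ring)]
        nlinarith [mul_nonneg hc (by linarith : 0 ≤ -(-(x - m) - r))]
    · refine ⟨x + (-(x - m) + r), ?_, ?_⟩
      · rw [key _ (by ring), hm]; ring
      · rw [key _ (by ring)]
        nlinarith [mul_nonneg (neg_nonneg.2 hc) (by linarith : 0 ≤ (-(x - m) + r))]

end RealAux

/-! ### The affine substitution, lifting and recovery -/

section Substitution

lemma quad_affine {n : ℕ} {ι : Type*} [Fintype ι] (Q : Matrix (Fin n) (Fin n) ℝ) (hQ : Q.IsSymm)
    (q p : Fin n → ℝ) (S : Matrix (Fin n) ι ℝ) (u : ι → ℝ) :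
    quad Q q (S *ᵥ u + p) =
      1 / 2 * (u ⬝ᵥ (Sᵀ * Q * S) *ᵥ u) + (Sᵀ *ᵥ (Q *ᵥ p + q)) ⬝ᵥ u + quad Q q p := by
  have h1 : u ⬝ᵥ (Sᵀ * Q * S) *ᵥ u = (S *ᵥ u) ⬝ᵥ Q *ᵥ (S *ᵥ u) := by
    rw [← mulVec_mulVec, ← mulVec_mulVec, dotProduct_mulVec, vecMul_transpose]
  have h2 : (Sᵀ *ᵥ (Q *ᵥ p + q)) ⬝ᵥ u = (Q *ᵥ p + q) ⬝ᵥ (S *ᵥ u) := by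
    rw [mulVec_transpose, dotProduct_mulVec]
  have h3 : p ⬝ᵥ Q *ᵥ (S *ᵥ u) = (S *ᵥ u) ⬝ᵥ Q *ᵥ p := by
    rw [dotProduct_mulVec, ← mulVec_transpose, hQ.eq, dotProduct_comm]
  rw [h1, h2]
  simp only [quad, mulVec_add, add_dotProduct, dotProduct_add, h3,
    dotProduct_comm (Q *ᵥ p) (S *ᵥ u)]
  ring

variable {n l k : ℕ}

lemma dotProduct_canonA_mulVec (α : Fin l → ℝ) (u : Idx l k → ℝ) :
    u ⬝ᵥ canonA k α *ᵥ u = ∑ i, α i * u (.inl i) ^ 2 +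
      ∑ j, 2 * (u (.inr (0, j)) * u (.inr (1, j))) := by
  simp only [canonA, dotProduct, mulVec, Fintype.sum_sum_type, fromBlocks_apply₁₁,
    fromBlocks_apply₁₂, fromBlocks_apply₂₁, fromBlocks_apply₂₂, Fintype.sum_prod_type,
    Fin.sum_univ_two, blockDiagonal_apply, E₂, diagonal_apply]
  simp
  rw [← Finset.sum_add_distrib]
  congr 1 <;> refine Finset.sum_congr rfl fun _ _ => by ring

lemma dotProduct_canonD_mulVec (δ : Fin l → ℝ) (ζ : Fin k → ℝ) (u : Idx l k → ℝ) :
    u ⬝ᵥ canonD δ ζ *ᵥ u = ∑ i, δ i * u (.inl i) ^ 2 +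
      ∑ j, (2 * ζ j * (u (.inr (0, j)) * u (.inr (1, j))) + u (.inr (1, j)) ^ 2) := by
  simp only [canonD, dotProduct, mulVec, Fintype.sum_sum_type, fromBlocks_apply₁₁,
    fromBlocks_apply₁₂, fromBlocks_apply₂₁, fromBlocks_apply₂₂, Fintype.sum_prod_type,
    Fin.sum_univ_two, blockDiagonal_apply, E₂, J₂, diagonal_apply]
  simp [Finset.sum_add_distrib, Matrix.mul_apply]
  simp only [← Finset.sum_add_distrib]
  congr 1 <;> refine Finset.sum_congr rfl fun _ _ => by ring

/-- The point of (IP₁) belonging to a point of (IP) in canonical coordinates. -/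
noncomputable def lift (u : Idx l k → ℝ) : SOCPVar l k :=
  ⟨fun i => u (.inl i), fun i => 1 / 2 * u (.inl i) ^ 2,
    fun j => u (.inr (0, j)) * u (.inr (1, j))⟩

lemma lift_tight (u : Idx l k → ℝ) : (lift u).Tight := fun _ => rfl

variable {P : IP n} {S : Matrix (Fin n) (Idx l k) ℝ} {p : Fin n → ℝ} {Q : SOCP l k}

lemma IsCanonicalForm.con_affine (hcan : IsCanonicalForm P S p Q) (hA : P.A.IsSymm)
    (u : Idx l k → ℝ) : P.con (S *ᵥ u + p) = Q.hbar (lift u) + P.con p := by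
  rw [IP.con, quad_affine _ hA, hcan.matA, hcan.linA, dotProduct_canonA_mulVec]
  simp only [SOCP.hbar, lift, dotProduct, Fintype.sum_sum_type, Sum.elim_inl, Sum.elim_inr,
    Pi.zero_apply, zero_mul, Finset.sum_const_zero, mul_add, Finset.mul_sum,
    Finset.sum_add_distrib]
  have e1 : ∀ i, 1 / 2 * (Q.α i * u (.inl i) ^ 2) = Q.α i * (1 / 2 * u (.inl i) ^ 2) :=
    fun i => by ring
  have e2 : ∀ j, 1 / 2 * (2 * (u (.inr (0, j)) * u (.inr (1, j)))) =
    u (.inr (0, j)) * u (.inr (1, j)) := fun j => by ring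
  simp only [e1, e2]
  ring

/-- In each block `½ s² + θ s = ½ (s + θ)² - ½ θ²`; the last terms add up to `c₀`. -/
lemma IsCanonicalForm.obj_affine (hcan : IsCanonicalForm P S p Q) (hD : P.D.IsSymm)
    (u : Idx l k → ℝ) : P.obj (S *ᵥ u + p) =
      Q.obj (lift u) + ∑ j, 1 / 2 * (u (.inr (1, j)) + Q.θ j) ^ 2 := by
  have hc := hcan.const
  rw [IP.obj] at hc ⊢
  rw [quad_affine _ hD, hcan.matD, hcan.linD, dotProduct_canonD_mulVec, ← hc]
  simp only [SOCP.obj, SOCP.c₀, lift, dotProduct, Fintype.sum_sum_type, Sum.elim_inl, Sum.elim_inr,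
    Fintype.sum_prod_type, Fin.sum_univ_two, mul_add, Finset.mul_sum, Finset.sum_add_distrib]
  have e1 : ∀ i, 1 / 2 * (Q.δ i * u (.inl i) ^ 2) = Q.δ i * (1 / 2 * u (.inl i) ^ 2) :=
    fun i => by ring
  have e2 : ∀ j, 1 / 2 * (2 * Q.ζ j * (u (.inr (0, j)) * u (.inr (1, j)))) =
    Q.ζ j * (u (.inr (0, j)) * u (.inr (1, j))) := fun j => by ring
  have e3 : ∀ j, 1 / 2 * (u (.inr (1, j)) + Q.θ j) ^ 2 = 1 / 2 * u (.inr (1, j)) ^ 2 +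
    Q.θ j * u (.inr (1, j)) + 1 / 2 * Q.θ j ^ 2 := fun j => by ring
  simp only [e1, e2, e3, Finset.sum_add_distrib]
  simp
  ring

lemma IsCanonicalForm.exists_eq_affine (hcan : IsCanonicalForm P S p Q) (x : Fin n → ℝ) :
    ∃ u, x = S *ᵥ u + p := by
  obtain ⟨T, hT, -⟩ := hcan.invertible
  exact ⟨T *ᵥ (x - p), by rw [mulVec_mulVec, hT, one_mulVec, sub_add_cancel]⟩

lemma IsCanonicalForm.affine_mem_feasible_iff (hcan : IsCanonicalForm P S p Q) (hA : P.A.IsSymm)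
    (u : Idx l k → ℝ) : S *ᵥ u + p ∈ P.feasible ↔ lift u ∈ Q.feasible := by
  have h := hcan.con_affine hA u
  have h1 := hcan.lower
  have h2 := hcan.upper
  constructor
  · rintro ⟨h3, h4⟩
    exact ⟨by linarith, by linarith, fun i => by simp [lift]⟩
  · rintro ⟨h3, h4, -⟩
    exact ⟨by linarith, by linarith⟩

lemma IsCanonicalForm.obj_lift_le (hcan : IsCanonicalForm P S p Q) (hD : P.D.IsSymm)
    (u : Idx l k → ℝ) : Q.obj (lift u) ≤ P.obj (S *ᵥ u + p) := by
  rw [hcan.obj_affine hD]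
  have : 0 ≤ ∑ j, 1 / 2 * (u (.inr (1, j)) + Q.θ j) ^ 2 :=
    Finset.sum_nonneg fun _ _ => by positivity
  linarith

/-- Congruence by an invertible matrix preserves `A ≠ 0`. This is how the constraint is known not to
be affine. -/
lemma IsCanonicalForm.exists_alpha_ne_zero_or_block (hcan : IsCanonicalForm P S p Q)
    (hA0 : P.A ≠ 0) : (∃ i, Q.α i ≠ 0) ∨ Nonempty (Fin k) := by
  by_contra! h
  obtain ⟨h1, h2⟩ := h
  obtain ⟨T, hT, -⟩ := hcan.invertible
  have hT' : Tᵀ * Sᵀ = 1 := by rw [← transpose_mul, hT, transpose_one]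
  apply hA0
  have h0 : canonA k Q.α = 0 := by
    have : Q.α = 0 := funext h1
    ext (i | ⟨_, j⟩) (i' | ⟨_, j'⟩)
    · simp [canonA, this]
    · exact h2.elim j'
    · exact h2.elim j
    · exact h2.elim j
  calc P.A = (Tᵀ * Sᵀ) * P.A * (S * T) := by rw [hT, hT', one_mul, mul_one]
    _ = Tᵀ * (Sᵀ * P.A * S) * T := by simp only [Matrix.mul_assoc]
    _ = 0 := by rw [hcan.matA, h0]; simp

lemma SOCP.z_eq_zero_of_second_eq_zero {M : ℝ} (hM : 0 < M) (w : SOCPVar l k) (j : Fin k)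
    (h : Q.second M w j = 0) : w.z j = 0 := by
  by_contra hz
  unfold SOCP.second at h
  split_ifs at h with hc
  · exact absurd h (by positivity)
  · exact hc ⟨by linarith, hz⟩

/-- The product `(z / s) * s` gives back `z`, and `s = 0` occurs only where `z = 0`. -/
lemma SOCP.lift_recover {M : ℝ} (hM : 0 < M) {w : SOCPVar l k} (hw : w.Tight) :
    lift (Q.recover M w) = w := by
  ext i
  · rfl
  · exact hw i
  · by_cases h : Q.second M w i = 0
    · simp [lift, SOCP.recover, h, Q.z_eq_zero_of_second_eq_zero hM w i h]
    · simp [lift, SOCP.recover, h]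

lemma SOCP.recover_second_add (M : ℝ) (w : SOCPVar l k) {j : Fin k} (hj : ¬ Q.Critical w j) :
    Q.recover M w (.inr (1, j)) + Q.θ j = 0 := by
  simp [SOCP.recover, SOCP.second, hj]

lemma SOCP.sum_recover_le {M : ℝ} (hM : 0 < M) (w : SOCPVar l k) :
    ∑ j, 1 / 2 * (Q.recover M w (.inr (1, j)) + Q.θ j) ^ 2 ≤ k * (1 / 2 * (1 / M) ^ 2) := by
  have : ∀ j ∈ Finset.univ, 1 / 2 * (Q.recover M w (.inr (1, j)) + Q.θ j) ^ 2 ≤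
      1 / 2 * (1 / M) ^ 2 := by
    intro j _
    by_cases hj : Q.Critical w j
    · have : Q.recover M w (.inr (1, j)) = 1 / M := by simp [SOCP.recover, SOCP.second, hj]
      rw [this, hj.1, add_zero]
    · rw [Q.recover_second_add M w hj]
      have : 0 ≤ (1 / M) ^ 2 := by positivity
      linarith
  simpa using Finset.sum_le_card_nsmul _ _ _ this

lemma IsCanonicalForm.recover_mem_feasible (hcan : IsCanonicalForm P S p Q) (hA : P.A.IsSymm)
    {M : ℝ} (hM : 0 < M) {w : SOCPVar l k} (hw : w.Tight) (hf : w ∈ Q.feasible) :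
    S *ᵥ Q.recover M w + p ∈ P.feasible := by
  rwa [hcan.affine_mem_feasible_iff hA, Q.lift_recover hM hw]

lemma IsCanonicalForm.obj_recover_of_forall_not_critical (hcan : IsCanonicalForm P S p Q)
    (hD : P.D.IsSymm) {M : ℝ} (hM : 0 < M) {w : SOCPVar l k} (hw : w.Tight)
    (h : ∀ j, ¬ Q.Critical w j) : P.obj (S *ᵥ Q.recover M w + p) = Q.obj w := by
  rw [hcan.obj_affine hD, Q.lift_recover hM hw, add_eq_left]
  exact Finset.sum_eq_zero fun j _ => by rw [Q.recover_second_add M w (h j)]; norm_num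

lemma IsCanonicalForm.exists_forall_obj_recover_lt (hcan : IsCanonicalForm P S p Q)
    (hD : P.D.IsSymm) {w : SOCPVar l k} (hw : w.Tight) {ε : ℝ} (hε : 0 < ε) :
    ∃ M₀ : ℝ, 0 < M₀ ∧ ∀ M, M₀ ≤ M → P.obj (S *ᵥ Q.recover M w + p) < Q.obj w + ε := by
  -- The excess is at most `k / (2 M²)`; `M ≥ 1` and `M > k / ε` bring it below `ε`.
  refine ⟨1 + k / ε, by positivity, fun M hM => ?_⟩
  have hk : (0 : ℝ) ≤ k / ε := by positivity
  have hM1 : 1 ≤ M := by linarith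
  have hM0 : 0 < M := by linarith
  rw [hcan.obj_affine hD, Q.lift_recover hM0 hw]
  have h1 := Q.sum_recover_le hM0 w
  have h2 : (k : ℝ) * (1 / 2 * (1 / M) ^ 2) < ε := by
    have hkM : (k : ℝ) < ε * M := by
      have : (k : ℝ) / ε < M := by linarith
      rw [div_lt_iff₀ hε] at this
      linarith
    have : (k : ℝ) * (1 / 2 * (1 / M) ^ 2) = k / (2 * M ^ 2) := by field_simp
    rw [this, div_lt_iff₀ (by positivity)]
    nlinarith [mul_le_mul_of_nonneg_left hM1 (mul_pos hε hM0).le, mul_pos hε hM0]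
  linarith

/-- Tight feasible points of (IP₁) bound the optimal value of (IP) from above. -/
lemma IsCanonicalForm.optVal_le_of_tight (hcan : IsCanonicalForm P S p Q) (hA : P.A.IsSymm)
    (hD : P.D.IsSymm) {w : SOCPVar l k} (hw : w.Tight) (hf : w ∈ Q.feasible) :
    optVal P.feasible P.obj ≤ (Q.obj w : EReal) := by
  refine le_of_forall_gt fun c hc => ?_
  obtain ⟨r, hr1, hr2⟩ := EReal.lt_iff_exists_real_btwn.1 hc
  obtain ⟨M, hM, h⟩ := hcan.exists_forall_obj_recover_lt hD hw
    (sub_pos.2 (EReal.coe_lt_coe_iff.1 hr1))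
  refine ((optVal_le (hcan.recover_mem_feasible hA hM hw hf)).trans_lt
    (EReal.coe_lt_coe_iff.2 ((h M le_rfl).trans_le ?_))).trans hr2
  linarith

lemma IsCanonicalForm.optVal_socp_le (hcan : IsCanonicalForm P S p Q) (hA : P.A.IsSymm)
    (hD : P.D.IsSymm) : optVal Q.feasible Q.obj ≤ optVal P.feasible P.obj := by
  refine le_iInf₂ fun x hx => ?_
  obtain ⟨u, rfl⟩ := hcan.exists_eq_affine x
  exact (optVal_le ((hcan.affine_mem_feasible_iff hA u).1 hx)).trans
    (EReal.coe_le_coe_iff.2 (hcan.obj_lift_le hD u))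

end Substitution

/-! ### Moves inside (IP₁), tight points and unboundedness -/

section SOCP

variable {l k : ℕ} (Q : SOCP l k) (w : SOCPVar l k)

/-- The cone constraints of (IP₁). -/
def SOCPVar.InCone {l k : ℕ} (w : SOCPVar l k) : Prop := ∀ i, 1 / 2 * w.x i ^ 2 - w.y i ≤ 0

variable {w} in
lemma SOCPVar.Tight.inCone (hw : w.Tight) : w.InCone := fun i => by rw [hw i, sub_self]

open Classical in
/-- Replace the variables `x i`, `y i` by `a`, `b`. -/
noncomputable def SOCPVar.setXY {l k : ℕ} (w : SOCPVar l k) (i : Fin l) (a b : ℝ) : SOCPVar l k :=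
  ⟨Function.update w.x i a, Function.update w.y i b, w.z⟩

open Classical in
/-- Replace the variable `z j` by `c`. -/
noncomputable def SOCPVar.setZ {l k : ℕ} (w : SOCPVar l k) (j : Fin k) (c : ℝ) : SOCPVar l k :=
  ⟨w.x, w.y, Function.update w.z j c⟩

lemma hbar_setXY (i : Fin l) (a b : ℝ) :
    Q.hbar (w.setXY i a b) = Q.hbar w + (Q.α i * (b - w.y i) + Q.β i * (a - w.x i)) := by
  rw [SOCP.hbar, sum_eq_sum_add_of_forall_ne (g := fun i => Q.α i * w.y i + Q.β i * w.x i) i]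
  · simp only [SOCP.hbar, SOCPVar.setXY, Function.update_self]
    ring
  · intro j hj
    simp [SOCPVar.setXY, hj]

lemma obj_setXY (i : Fin l) (a b : ℝ) :
    Q.obj (w.setXY i a b) = Q.obj w + (Q.δ i * (b - w.y i) + Q.η i * (a - w.x i)) := by
  rw [SOCP.obj, sum_eq_sum_add_of_forall_ne (g := fun i => Q.δ i * w.y i + Q.η i * w.x i) i]
  · simp only [SOCP.obj, SOCPVar.setXY, Function.update_self]
    ring
  · intro j hj
    simp [SOCPVar.setXY, hj]

lemma hbar_setZ (j : Fin k) (c : ℝ) : Q.hbar (w.setZ j c) = Q.hbar w + (c - w.z j) := by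
  rw [SOCP.hbar, sum_eq_sum_add_of_forall_ne (g := fun j => w.z j) j]
  · simp only [SOCP.hbar, SOCPVar.setZ, Function.update_self]
    ring
  · intro j' hj
    simp [SOCPVar.setZ, hj]

lemma obj_setZ (j : Fin k) (c : ℝ) : Q.obj (w.setZ j c) = Q.obj w + Q.ζ j * (c - w.z j) := by
  rw [SOCP.obj, sum_eq_sum_add_of_forall_ne (g := fun j => Q.ζ j * w.z j) j]
  · simp only [SOCP.obj, SOCPVar.setZ, Function.update_self]
    ring
  · intro j' hj
    simp [SOCPVar.setZ, hj]

variable {w}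

lemma SOCPVar.InCone.setXY (hw : w.InCone) (i : Fin l) {a b : ℝ} (h : 1 / 2 * a ^ 2 - b ≤ 0) :
    (w.setXY i a b).InCone := by
  intro j
  rcases eq_or_ne j i with rfl | hj
  · simpa [SOCPVar.setXY] using h
  · simpa [SOCPVar.setXY, hj] using hw j

lemma SOCPVar.InCone.setZ (hw : w.InCone) (j : Fin k) (c : ℝ) : (w.setZ j c).InCone := hw

lemma SOCPVar.Tight.setXY (hw : w.Tight) (i : Fin l) (a : ℝ) :
    (w.setXY i a (1 / 2 * a ^ 2)).Tight := by
  intro j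
  rcases eq_or_ne j i with rfl | hj
  · simp [SOCPVar.setXY]
  · simpa [SOCPVar.setXY, hj] using hw j

lemma SOCPVar.Tight.setZ (hw : w.Tight) (j : Fin k) (c : ℝ) : (w.setZ j c).Tight := hw

variable {Q}

/-- Passing to a tight point with the same constraint value and no larger objective value. -/
lemma exists_tight_of_inCone (hδ : ∀ i, Q.α i = 0 → 0 ≤ Q.δ i) (hw : w.InCone) :
    ∃ w' : SOCPVar l k, w'.Tight ∧ w'.z = w.z ∧ Q.hbar w' = Q.hbar w ∧ Q.obj w' ≤ Q.obj w := by
  choose x' h1 h2 using fun i => exists_tight_coordinate (β := Q.β i) (η := Q.η i) (hδ i) (hw i)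
  refine ⟨⟨x', fun i => 1 / 2 * x' i ^ 2, w.z⟩, fun _ => rfl, rfl, ?_, ?_⟩
  · simp only [SOCP.hbar, h1]
  · have := Finset.sum_le_sum fun i (_ : i ∈ Finset.univ) => h2 i
    simp only [SOCP.obj]
    linarith

lemma mem_feasible_of_hbar_eq {w' : SOCPVar l k} (hw : w ∈ Q.feasible) (hc : w'.InCone)
    (h : Q.hbar w' = Q.hbar w) : w' ∈ Q.feasible :=
  ⟨h ▸ hw.1, h ▸ hw.2.1, hc⟩

/-- The constraint does not see `y_i`, and the cone lets it grow without limit. -/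
lemma delta_nonneg_of_forall_le {m : ℝ} (hm : ∀ w ∈ Q.feasible, m ≤ Q.obj w)
    (hw : w ∈ Q.feasible) {i : Fin l} (hα : Q.α i = 0) : 0 ≤ Q.δ i := by
  by_contra! hδ
  -- The minimum with the current objective value forces `t ≥ 0`, so that the cone is not left.
  obtain ⟨t, ht⟩ := exists_linear_eq hδ.ne (Q.obj w) (min (m - 1) (Q.obj w))
  have ht0 : 0 ≤ t := by nlinarith [min_le_right (m - 1) (Q.obj w)]
  have hc : (w.setXY i (w.x i) (w.y i + t)).InCone :=
    SOCPVar.InCone.setXY hw.2.2 i (by linarith [hw.2.2 i])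
  have := hm _ (mem_feasible_of_hbar_eq hw hc (by rw [hbar_setXY, hα]; ring))
  rw [obj_setXY] at this
  have h2 := min_le_left (m - 1) (Q.obj w)
  linarith

lemma IsOptimal.exists_tight (hw : IsOptimal Q.feasible Q.obj w) :
    ∃ w', IsOptimal Q.feasible Q.obj w' ∧ w'.Tight ∧ w'.z = w.z := by
  obtain ⟨w', h1, h2, h3, h4⟩ :=
    exists_tight_of_inCone (fun i => delta_nonneg_of_forall_le hw.2 hw.1) hw.1.2.2
  exact ⟨w', ⟨mem_feasible_of_hbar_eq hw.1 h1.inCone h3, fun v hv => h4.trans (hw.2 v hv)⟩, h1, h2⟩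

/-- A coordinate that is concave in the objective and linear in the constraint drives the objective
to `-∞` along tight points, provided the constraint is not affine. -/
lemma exists_tight_obj_le (hne : (∃ i, Q.α i ≠ 0) ∨ Nonempty (Fin k)) (hw : w.Tight) {i : Fin l}
    (hα : Q.α i = 0) (hδ : Q.δ i < 0) (C : ℝ) :
    ∃ w' : SOCPVar l k, w'.Tight ∧ Q.hbar w' = Q.hbar w ∧ Q.obj w' ≤ C := by
  rcases hne with ⟨i', hi'⟩ | ⟨⟨j⟩⟩
  · rcases eq_or_ne (Q.β i) 0 with hβ | hβ
    -- With `β_i = 0` the coordinate is free. Setting `x_i = t²` makes the objective a quartic in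
    -- `t`.
    · obtain ⟨t, ht⟩ := exists_quartic_le (a := Q.δ i * (1 / 2)) (by linarith) 0 (Q.η i) 0
        (Q.obj w - Q.δ i * w.y i - Q.η i * w.x i) C
      refine ⟨_, hw.setXY i (t ^ 2), ?_, ?_⟩
      · rw [hbar_setXY, hα, hβ]; ring
      · rw [obj_setXY]
        refine le_trans (le_of_eq ?_) ht
        ring
    · have hii : i ≠ i' := by rintro rfl; exact hi' hα
      obtain ⟨g, hg⟩ : ∃ g, Q.β i * g = 1 := ⟨1 / Q.β i, by field_simp⟩
      have hg0 : g ≠ 0 := by rintro rfl; simp at hg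
      -- Let `x_{i'} = t` and solve the constraint for `x_i`, giving `a t² + b t + c`. As `α_{i'} ≠
      -- 0` implies `a ≠ 0`, the term `½ δ_i x_i²` is a quartic with negative leading coefficient.
      set c := w.x i + (Q.α i' * w.y i' + Q.β i' * w.x i') * g with hc
      set a := -(g * Q.α i' * (1 / 2)) with ha
      set b := -(g * Q.β i') with hb
      have ha0 : a ≠ 0 := by
        rw [ha]; exact neg_ne_zero.2 (mul_ne_zero (mul_ne_zero hg0 hi') (by norm_num))
      have hlead : Q.δ i * (1 / 2) * a ^ 2 < 0 :=
        mul_neg_of_neg_of_pos (by linarith) (by positivity)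
      obtain ⟨t, ht⟩ := exists_quartic_le hlead (Q.δ i * a * b)
        (Q.δ i * (1 / 2) * (b ^ 2 + 2 * a * c) + Q.η i * a + Q.δ i' * (1 / 2))
        (Q.δ i * b * c + Q.η i * b + Q.η i')
        (Q.obj w + Q.δ i * (1 / 2 * c ^ 2 - w.y i) + Q.η i * (c - w.x i)
          - Q.δ i' * w.y i' - Q.η i' * w.x i') C
      have hx : (w.setXY i' t (1 / 2 * t ^ 2)).x i = w.x i := by simp [SOCPVar.setXY, hii]
      have hy : (w.setXY i' t (1 / 2 * t ^ 2)).y i = w.y i := by simp [SOCPVar.setXY, hii]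
      refine ⟨_, (hw.setXY i' t).setXY i (a * t ^ 2 + b * t + c), ?_, ?_⟩
      · rw [hbar_setXY, hbar_setXY, hα, hx, ha, hb, hc]
        linear_combination (-(Q.α i' * (1 / 2)) * t ^ 2 - Q.β i' * t +
          (Q.α i' * w.y i' + Q.β i' * w.x i')) * hg
      · rw [obj_setXY, obj_setXY, hx, hy]
        refine le_trans (le_of_eq ?_) ht
        ring
  -- Here `z_j` absorbs the change `β_i (t² - x_i)` at a cost only quadratic in `t`.
  · obtain ⟨t, ht⟩ := exists_quartic_le (a := Q.δ i * (1 / 2)) (by linarith) 0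
      (Q.η i - Q.ζ j * Q.β i) 0
      (Q.obj w - Q.δ i * w.y i - Q.η i * w.x i + Q.ζ j * Q.β i * w.x i) C
    refine ⟨_, (hw.setXY i (t ^ 2)).setZ j (w.z j - Q.β i * (t ^ 2 - w.x i)), ?_, ?_⟩
    · rw [hbar_setZ, hbar_setXY, hα]
      simp only [SOCPVar.setXY]
      ring
    · rw [obj_setZ, obj_setXY]
      refine le_trans (le_of_eq ?_) ht
      simp only [SOCPVar.setXY]
      ring

end SOCP

/-! ### Equality of the optimal values -/

section OptimalValue

variable {n l k : ℕ} {P : IP n} {S : Matrix (Fin n) (Idx l k) ℝ} {p : Fin n → ℝ} {Q : SOCP l k}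

lemma IsCanonicalForm.socp_feasible_nonempty (hcan : IsCanonicalForm P S p Q) (hA : P.A.IsSymm)
    (hfeas : P.feasible.Nonempty) : ∃ w ∈ Q.feasible, w.Tight := by
  obtain ⟨x, hx⟩ := hfeas
  obtain ⟨u, rfl⟩ := hcan.exists_eq_affine x
  exact ⟨lift u, (hcan.affine_mem_feasible_iff hA u).1 hx, lift_tight u⟩

/-- (IP) and (IP₁) have the same optimal value. -/
lemma IsCanonicalForm.optVal_eq (hcan : IsCanonicalForm P S p Q) (hA : P.A.IsSymm)
    (hD : P.D.IsSymm) (hfeas : P.feasible.Nonempty) (hA0 : P.A ≠ 0) :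
    optVal P.feasible P.obj = optVal Q.feasible Q.obj := by
  refine le_antisymm ?_ (hcan.optVal_socp_le hA hD)
  by_cases h : ∀ i, Q.α i = 0 → 0 ≤ Q.δ i
  · refine le_iInf₂ fun w hw => ?_
    obtain ⟨w', h1, -, h3, h4⟩ := exists_tight_of_inCone h hw.2.2
    exact (hcan.optVal_le_of_tight hA hD h1 (mem_feasible_of_hbar_eq hw h1.inCone h3)).trans
      (EReal.coe_le_coe_iff.2 h4)
  -- Tightening is impossible here, so unboundedness is shown for (IP) directly, through tight
  -- points.
  · push Not at h
    obtain ⟨i, hα, hδ⟩ := h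
    obtain ⟨w, hw, hwt⟩ := hcan.socp_feasible_nonempty hA hfeas
    have : optVal P.feasible P.obj = ⊥ := by
      rw [EReal.eq_bot_iff_forall_lt]
      intro C
      obtain ⟨w', h1, h2, h3⟩ := exists_tight_obj_le
        (hcan.exists_alpha_ne_zero_or_block hA0) hwt hα hδ (C - 1)
      exact (hcan.optVal_le_of_tight hA hD h1 (mem_feasible_of_hbar_eq hw h1.inCone h2)).trans_lt
        (EReal.coe_lt_coe_iff.2 (by linarith))
    rw [this]
    exact bot_le

/-- Shifting `t` from `z_j` to `z_i` keeps the constraint value and changes the objective by `(ζ_i -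
ζ_j) t`. -/
lemma socp_optVal_eq_bot {w : SOCPVar l k} (hw : w ∈ Q.feasible) {i j : Fin k}
    (hij : Q.ζ i ≠ Q.ζ j) : optVal Q.feasible Q.obj = ⊥ := by
  refine optVal_eq_bot_of_forall fun C => ?_
  obtain ⟨t, ht⟩ := exists_linear_eq (sub_ne_zero.2 hij) (Q.obj w) C
  have hne : j ≠ i := by rintro rfl; exact hij rfl
  have hz : (w.setZ i (w.z i + t)).z j = w.z j := by simp [SOCPVar.setZ, hne]
  refine ⟨(w.setZ i (w.z i + t)).setZ j (w.z j - t), mem_feasible_of_hbar_eq hw hw.2.2 ?_, ?_⟩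
  · rw [hbar_setZ, hbar_setZ, hz]; ring
  · rw [obj_setZ, obj_setZ, hz, ← ht]
    exact le_of_eq (by ring)

end OptimalValue

/-! ### Solvability of (IP₁) -/

section Existence

lemma exists_abs_le_of_quadratic_le {d : ℝ} (hd : 0 < d) (q T : ℝ) :
    ∃ R : ℝ, ∀ x : ℝ, d * (1 / 2 * x ^ 2) + q * x ≤ T → |x| ≤ R := by
  refine ⟨1 + 2 * (|q| + |T|) / d, fun x hx => ?_⟩
  by_contra! h
  have h0 : 0 ≤ 2 * (|q| + |T|) / d := by positivity
  have h1 : 1 < |x| := by linarith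
  have h2 : 2 * (|q| + |T|) < d * |x| := by
    have : 2 * (|q| + |T|) / d < |x| := by linarith
    rw [div_lt_iff₀ hd] at this
    linarith
  have h3 : -(|q| * |x|) ≤ q * x := by rw [← abs_mul]; exact neg_abs_le _
  rw [← sq_abs x] at hx
  nlinarith [le_abs_self T, abs_nonneg T, mul_pos (by linarith : 0 < |x|) (sub_pos.2 h2),
    mul_nonneg (abs_nonneg T) (sub_pos.2 h1).le]

lemma quadratic_vertex_le {d q x y : ℝ} (hd : 0 ≤ d) (hq : d = 0 → q = 0)
    (hxy : 1 / 2 * x ^ 2 - y ≤ 0) :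
    d * (1 / 2 * (-q / d) ^ 2) + q * (-q / d) ≤ d * y + q * x := by
  rcases hd.eq_or_lt with h | h
  · simp [← h, hq h.symm]
  · obtain ⟨r, rfl⟩ : ∃ r, q = d * r := ⟨q / d, by field_simp⟩
    rw [show -(d * r) / d = -r by field_simp]
    nlinarith [mul_nonneg hd (sq_nonneg (x + r)), mul_nonneg hd (by linarith : 0 ≤ y - 1 / 2 * x ^ 2)]

variable {l k : ℕ} {Q : SOCP l k} {w₀ : SOCPVar l k} {m : ℝ}

lemma obj_add_mul_hbar (Q : SOCP l k) (μ : ℝ) (w : SOCPVar l k) :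
    Q.obj w + μ * Q.hbar w =
      ∑ i, ((Q.δ i + μ * Q.α i) * w.y i + (Q.η i + μ * Q.β i) * w.x i) +
        ∑ j, (Q.ζ j + μ) * w.z j + Q.c₀ + Q.const := by
  simp only [SOCP.obj, SOCP.hbar, mul_add, add_mul, Finset.mul_sum, Finset.sum_add_distrib,
    mul_assoc]
  ring

/-- If the constraint value can be changed freely without changing `obj + μ hbar`, then
(IP₁) is solvable as soon as it is bounded from below. -/
lemma exists_isOptimal_of_adjustable (hw₀ : w₀ ∈ Q.feasible) (hm : ∀ w ∈ Q.feasible, m ≤ Q.obj w)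
    (μ : ℝ) (hadj : ∀ w : SOCPVar l k, w.InCone → ∀ t, ∃ w' : SOCPVar l k, w'.InCone ∧
      Q.obj w' + μ * Q.hbar w' = Q.obj w + μ * Q.hbar w ∧ Q.hbar w' = t) :
    ∃ w, IsOptimal Q.feasible Q.obj w := by
  have hc : Q.c₁ ≤ Q.c₂ := hw₀.1.trans hw₀.2.1
  have hcone : w₀.InCone := hw₀.2.2
  obtain ⟨B, hB⟩ : ∃ B, ∀ w : SOCPVar l k, w.InCone → B ≤ Q.obj w + μ * Q.hbar w := by
    -- Adjusting the constraint value to `c₁` makes any cone point feasible, so the Lagrangian is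
    -- bounded below on the whole cone. Being separable, it must then have no linear escape
    -- direction, which is what the next three facts record.
    refine ⟨m + μ * Q.c₁, fun w hw => ?_⟩
    obtain ⟨w', h1, h2, h3⟩ := hadj w hw Q.c₁
    have := hm w' ⟨h3.ge, h3.le.trans hc, h1⟩
    rw [h3] at h2
    linarith
  have hζ : ∀ j, Q.ζ j + μ = 0 := by
    intro j
    by_contra hne
    obtain ⟨t, ht⟩ := exists_linear_eq hne (Q.obj w₀ + μ * Q.hbar w₀) (B - 1)
    have := hB _ (hcone.setZ j (w₀.z j + t))
    rw [obj_setZ, hbar_setZ] at this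
    linarith
  have hδ : ∀ i, 0 ≤ Q.δ i + μ * Q.α i := by
    intro i
    by_contra! hne
    have h0 := hB _ hcone
    obtain ⟨t, ht⟩ := exists_linear_eq hne.ne (Q.obj w₀ + μ * Q.hbar w₀) (B - 1)
    have ht0 : 0 ≤ t := by nlinarith
    have := hB _ (hcone.setXY i (a := w₀.x i) (b := w₀.y i + t) (by linarith [hcone i]))
    rw [obj_setXY, hbar_setXY] at this
    linarith
  have hη : ∀ i, Q.δ i + μ * Q.α i = 0 → Q.η i + μ * Q.β i = 0 := by
    intro i h
    by_contra hne
    obtain ⟨t, ht⟩ := exists_linear_eq hne (Q.obj w₀ + μ * Q.hbar w₀ -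
      (Q.η i + μ * Q.β i) * w₀.x i) (B - 1)
    have := hB _ (hcone.setXY i (a := t) (b := 1 / 2 * t ^ 2) (by simp))
    rw [obj_setXY, hbar_setXY] at this
    have h' : (Q.δ i + μ * Q.α i) * (1 / 2 * t ^ 2 - w₀.y i) = 0 := by rw [h, zero_mul]
    linarith
  -- Coordinatewise vertices. Where the denominator is 0 the quotient is 0, which is harmless
  -- because the numerator vanishes too.
  set v : SOCPVar l k := ⟨fun i => -(Q.η i + μ * Q.β i) / (Q.δ i + μ * Q.α i),
    fun i => 1 / 2 * (-(Q.η i + μ * Q.β i) / (Q.δ i + μ * Q.α i)) ^ 2, fun _ => 0⟩ with hv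
  have hvmin : ∀ w : SOCPVar l k, w.InCone →
      Q.obj v + μ * Q.hbar v ≤ Q.obj w + μ * Q.hbar w := by
    intro w hw
    rw [obj_add_mul_hbar, obj_add_mul_hbar]
    simp only [hζ, zero_mul]
    have := Finset.sum_le_sum fun i (_ : i ∈ Finset.univ) =>
      quadratic_vertex_le (hδ i) (hη i) (hw i)
    linarith
  have hvcone : v.InCone := fun i => by simp [hv]
  -- The objective is the Lagrangian minus `μ` times the constraint value, so the best value is an
  -- endpoint chosen by the sign of `μ`.
  obtain ⟨t, ht1, ht2, ht⟩ : ∃ t, Q.c₁ ≤ t ∧ t ≤ Q.c₂ ∧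
      ∀ s, Q.c₁ ≤ s → s ≤ Q.c₂ → μ * s ≤ μ * t := by
    rcases le_total 0 μ with h | h
    · exact ⟨Q.c₂, hc, le_rfl, fun s _ hs => mul_le_mul_of_nonneg_left hs h⟩
    · exact ⟨Q.c₁, le_rfl, hc, fun s hs _ => mul_le_mul_of_nonpos_left hs h⟩
  obtain ⟨w', h1, h2, h3⟩ := hadj v hvcone t
  refine ⟨w', ⟨ht1.trans h3.ge, h3.le.trans ht2, h1⟩, fun w hw => ?_⟩
  have := hvmin w hw.2.2
  have := ht _ hw.1 hw.2.1
  rw [h3] at h2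
  linarith

/-- For `μ = -ζ_j` the free variable `z_j` drops out of the Lagrangian. -/
lemma exists_isOptimal_of_block (hw₀ : w₀ ∈ Q.feasible) (hm : ∀ w ∈ Q.feasible, m ≤ Q.obj w)
    (j : Fin k) : ∃ w, IsOptimal Q.feasible Q.obj w := by
  refine exists_isOptimal_of_adjustable hw₀ hm (-Q.ζ j) fun w hw t =>
    ⟨w.setZ j (w.z j + (t - Q.hbar w)), hw.setZ j _, ?_, ?_⟩
  · rw [obj_setZ, hbar_setZ]; ring
  · rw [hbar_setZ]; ring

lemma exists_isOptimal_of_linear (hw₀ : w₀ ∈ Q.feasible) (hm : ∀ w ∈ Q.feasible, m ≤ Q.obj w)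
    {i : Fin l} (hα : Q.α i = 0) (hδ : Q.δ i = 0) (hβ : Q.β i ≠ 0) :
    ∃ w, IsOptimal Q.feasible Q.obj w := by
  refine exists_isOptimal_of_adjustable hw₀ hm (-Q.η i / Q.β i) fun w hw t => ?_
  set a := w.x i + (t - Q.hbar w) / Q.β i with ha
  refine ⟨w.setXY i a (1 / 2 * a ^ 2), hw.setXY i (by simp), ?_, ?_⟩
  · rw [obj_setXY, hbar_setXY, hα, hδ, ha]
    field_simp
    ring
  · rw [hbar_setXY, hα, ha]
    field_simp
    ring

/-- With minus the common ratio as multiplier, neither `y_i` nor `y_{i'}` occurs in the Lagrangian;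
increasing the first raises the constraint value, increasing the second lowers it. -/
lemma exists_isOptimal_of_opposite (hw₀ : w₀ ∈ Q.feasible) (hm : ∀ w ∈ Q.feasible, m ≤ Q.obj w)
    {i i' : Fin l} (hα : 0 < Q.α i) (hα' : Q.α i' < 0) (h : Q.δ i / Q.α i = Q.δ i' / Q.α i') :
    ∃ w, IsOptimal Q.feasible Q.obj w := by
  have key : ∀ r : Fin l, Q.α r ≠ 0 → Q.δ r / Q.α r = Q.δ i / Q.α i → ∀ w : SOCPVar l k,
      w.InCone → ∀ t, 0 ≤ (t - Q.hbar w) / Q.α r → ∃ w' : SOCPVar l k, w'.InCone ∧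
        Q.obj w' + -(Q.δ i / Q.α i) * Q.hbar w' = Q.obj w + -(Q.δ i / Q.α i) * Q.hbar w ∧
        Q.hbar w' = t := by
    intro r hr hri w hw t ht
    refine ⟨w.setXY r (w.x r) (w.y r + (t - Q.hbar w) / Q.α r),
      hw.setXY r (by linarith [hw r]), ?_, ?_⟩
    · rw [obj_setXY, hbar_setXY, ← hri]
      field_simp
      ring
    · rw [hbar_setXY]
      field_simp
      ring
  refine exists_isOptimal_of_adjustable hw₀ hm (-(Q.δ i / Q.α i)) fun w hw t => ?_
  rcases le_total (Q.hbar w) t with ht | ht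
  · exact key i hα.ne' rfl w hw t (div_nonneg (sub_nonneg.2 ht) hα.le)
  · exact key i' hα'.ne h.symm w hw t (div_nonneg_of_nonpos (sub_nonpos.2 ht) hα'.le)

/-- Otherwise, raising `y_i` by `t / α_i` and `y_{i'}` by `-t / α_{i'}` keeps the constraint value
while the objective tends to `-∞`. -/
lemma div_le_div_of_opposite (hw₀ : w₀ ∈ Q.feasible) (hm : ∀ w ∈ Q.feasible, m ≤ Q.obj w)
    {i i' : Fin l} (hα : 0 < Q.α i) (hα' : Q.α i' < 0) : Q.δ i' / Q.α i' ≤ Q.δ i / Q.α i := by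
  by_contra! h
  have hii : i' ≠ i := by rintro rfl; linarith
  obtain ⟨t, ht⟩ := exists_linear_eq (sub_neg.2 h).ne (Q.obj w₀) (m - 1)
  have ht0 : 0 ≤ t := by nlinarith [hm _ hw₀]
  have hcone : w₀.InCone := hw₀.2.2
  have hx : (w₀.setXY i (w₀.x i) (w₀.y i + t / Q.α i)).x i' = w₀.x i' := by
    simp [SOCPVar.setXY]
  have hy : (w₀.setXY i (w₀.x i) (w₀.y i + t / Q.α i)).y i' = w₀.y i' := by
    simp [SOCPVar.setXY, hii]
  have hp : 0 ≤ t / Q.α i := div_nonneg ht0 hα.le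
  have hp' : 0 ≤ -t / Q.α i' := div_nonneg_of_nonpos (neg_nonpos.2 ht0) hα'.le
  have h1 : ((w₀.setXY i (w₀.x i) (w₀.y i + t / Q.α i)).setXY i' (w₀.x i')
      (w₀.y i' + -t / Q.α i')).InCone :=
    (hcone.setXY i (by linarith [hcone i])).setXY i' (by linarith [hcone i'])
  have := hm _ (mem_feasible_of_hbar_eq hw₀ h1 (by
    have := hα'.ne
    rw [hbar_setXY, hbar_setXY, hx, hy]
    field_simp
    ring))
  rw [obj_setXY, obj_setXY, hx, hy] at this
  have e : Q.δ i * (w₀.y i + t / Q.α i - w₀.y i) + Q.δ i' * (w₀.y i' + -t / Q.α i' - w₀.y i') =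
      (Q.δ i / Q.α i - Q.δ i' / Q.α i') * t := by ring
  linarith

lemma eta_eq_zero_of_forall_le (hw₀ : w₀ ∈ Q.feasible) (hm : ∀ w ∈ Q.feasible, m ≤ Q.obj w)
    {i : Fin l} (hα : Q.α i = 0) (hδ : Q.δ i = 0) (hβ : Q.β i = 0) : Q.η i = 0 := by
  by_contra hη
  obtain ⟨t, ht⟩ := exists_linear_eq hη (Q.obj w₀ - Q.η i * w₀.x i) (m - 1)
  have hcone : w₀.InCone := hw₀.2.2
  have := hm _ (mem_feasible_of_hbar_eq hw₀ (hcone.setXY i (a := t) (b := 1 / 2 * t ^ 2) (by simp))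
    (by rw [hbar_setXY, hα, hβ]; ring))
  rw [obj_setXY, hδ] at this
  linarith

/-- Solvability of (IP₁) when some Lagrangian is strictly convex in all variables that occur. -/
lemma exists_isOptimal_of_coercive [IsEmpty (Fin k)] (hw₀ : w₀ ∈ Q.feasible)
    (hδ : ∀ i, Q.α i = 0 → 0 ≤ Q.δ i) (μ : ℝ)
    (hμ : ∀ i, 0 < Q.δ i + μ * Q.α i ∨ (Q.α i = 0 ∧ Q.β i = 0 ∧ Q.δ i = 0 ∧ Q.η i = 0)) :
    ∃ w, IsOptimal Q.feasible Q.obj w := by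
  classical
  set F : (Fin l → ℝ) → SOCPVar l k := fun x => ⟨x, fun i => 1 / 2 * x i ^ 2, w₀.z⟩ with hF
  have hFt : ∀ x, (F x).Tight := fun x i => rfl
  have hobj : Continuous fun x => Q.obj (F x) := by
    simp only [hF, SOCP.obj]; fun_prop
  have hhbar : Continuous fun x => Q.hbar (F x) := by
    simp only [hF, SOCP.hbar]; fun_prop
  set d := fun i => Q.δ i + μ * Q.α i with hd
  set q := fun i => Q.η i + μ * Q.β i with hq
  have hd0 : ∀ i, 0 ≤ d i := fun i => by
    rcases hμ i with h | ⟨h1, -, h2, -⟩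
    · exact h.le
    · simp [hd, h1, h2]
  have hq0 : ∀ i, d i = 0 → q i = 0 := fun i hi => by
    rcases hμ i with h | ⟨-, h1, -, h2⟩
    · exact absurd hi h.ne'
    · simp [hq, h1, h2]
  -- `B i` is the least value of the `i`-th Lagrangian term. On the sublevel set of `w₀` the
  -- excesses over these minima add up to at most `T`, so each term is at most `T + B i`, which
  -- bounds `x_i`.
  set B := fun i => d i * (1 / 2 * (-q i / d i) ^ 2) + q i * (-q i / d i) with hB
  set T := Q.obj w₀ + max (μ * Q.c₁) (μ * Q.c₂) - Q.c₀ - Q.const - ∑ i, B i with hT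
  have hR : ∀ i, ∃ R : ℝ, 0 ≤ R ∧
      (0 < d i → ∀ x : ℝ, d i * (1 / 2 * x ^ 2) + q i * x ≤ T + B i → |x| ≤ R) := by
    intro i
    by_cases hi : 0 < d i
    · obtain ⟨R, hR⟩ := exists_abs_le_of_quadratic_le hi (q i) (T + B i)
      exact ⟨max R 0, le_max_right _ _, fun _ x hx => (hR x hx).trans (le_max_left _ _)⟩
    · exact ⟨0, le_rfl, fun h => absurd h hi⟩
  choose R hR0 hR using hR
  set K : Set (Fin l → ℝ) := Set.pi Set.univ (fun i => Set.Icc (-R i) (R i)) ∩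
    {x | Q.c₁ ≤ Q.hbar (F x) ∧ Q.hbar (F x) ≤ Q.c₂} with hK
  have hKc : IsCompact K := by
    refine (isCompact_univ_pi fun i => isCompact_Icc).inter_right ?_
    exact (isClosed_le continuous_const hhbar).inter (isClosed_le hhbar continuous_const)
  have main : ∀ w ∈ Q.feasible, Q.obj w ≤ Q.obj w₀ → ∃ x ∈ K, Q.obj (F x) ≤ Q.obj w := by
    intro w hw hle
    obtain ⟨v, hv1, -, hv3, hv4⟩ := exists_tight_of_inCone hδ hw.2.2
    have hvf : v ∈ Q.feasible := mem_feasible_of_hbar_eq hw hv1.inCone hv3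
    -- Coordinates that occur nowhere are set to 0, so that the point lies in the compact set `K`.
    set x : Fin l → ℝ := fun i => if 0 < d i then v.x i else 0 with hx
    have hzero : ∀ i, ¬ 0 < d i → Q.α i = 0 ∧ Q.β i = 0 ∧ Q.δ i = 0 ∧ Q.η i = 0 :=
      fun i hi => (hμ i).resolve_left hi
    have eh : Q.hbar (F x) = Q.hbar v := by
      simp only [SOCP.hbar, hF, Finset.univ_eq_empty, Finset.sum_empty]
      congr 1
      refine Finset.sum_congr rfl fun i _ => ?_
      by_cases hi : 0 < d i
      · simp only [hx, hi, if_true, ← hv1 i]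
      · simp [hzero i hi]
    have eo : Q.obj (F x) = Q.obj v := by
      simp only [SOCP.obj, hF, Finset.univ_eq_empty, Finset.sum_empty]
      congr 3
      refine Finset.sum_congr rfl fun i _ => ?_
      by_cases hi : 0 < d i
      · simp only [hx, hi, if_true, ← hv1 i]
      · simp [hzero i hi]
    refine ⟨x, ⟨fun i _ => abs_le.1 ?_, by rw [eh]; exact hvf.1, by rw [eh]; exact hvf.2.1⟩,
      by rw [eo]; exact hv4⟩
    by_cases hi : 0 < d i
    · simp only [hx, hi, if_true]
      refine hR i hi _ ?_
      have hL := obj_add_mul_hbar Q μ v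
      have hmu : μ * Q.hbar v ≤ max (μ * Q.c₁) (μ * Q.c₂) := by
        rcases le_total 0 μ with h | h
        · exact (mul_le_mul_of_nonneg_left hvf.2.1 h).trans (le_max_right _ _)
        · exact (mul_le_mul_of_nonpos_left hvf.1 h).trans (le_max_left _ _)
      have hterm := Finset.single_le_sum (f := fun r => d r * v.y r + q r * v.x r - B r)
        (fun r _ => sub_nonneg.2 (quadratic_vertex_le (hd0 r) (hq0 r) (hv1.inCone r)))
        (Finset.mem_univ i)
      rw [Finset.sum_sub_distrib] at hterm
      simp only [Finset.univ_eq_empty (α := Fin k), Finset.sum_empty] at hL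
      rw [hv1 i]
      linarith
    · simp [hx, hi, hR0 i]
  obtain ⟨x₀, hx₀, -⟩ := main w₀ hw₀ le_rfl
  obtain ⟨x, hxK, hxmin⟩ := hKc.exists_isMinOn ⟨x₀, hx₀⟩ hobj.continuousOn
  refine ⟨F x, ⟨hxK.2.1, hxK.2.2, (hFt x).inCone⟩, fun w hw => ?_⟩
  have hcmp : ∀ w ∈ Q.feasible, Q.obj w ≤ Q.obj w₀ → Q.obj (F x) ≤ Q.obj w := by
    intro w hw hle
    obtain ⟨x', hx', h⟩ := main w hw hle
    exact (isMinOn_iff.1 hxmin x' hx').trans h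
  rcases le_total (Q.obj w) (Q.obj w₀) with h | h
  · exact hcmp w hw h
  · exact (hcmp w₀ hw₀ le_rfl).trans h

/-- (IP₁) is solvable if it is feasible and bounded from below. -/
lemma exists_isOptimal (hw₀ : w₀ ∈ Q.feasible) (hm : ∀ w ∈ Q.feasible, m ≤ Q.obj w) :
    ∃ w, IsOptimal Q.feasible Q.obj w := by
  classical
  rcases isEmpty_or_nonempty (Fin k) with hk | ⟨⟨j⟩⟩
  swap
  · exact exists_isOptimal_of_block hw₀ hm j
  by_cases h1 : ∃ i, Q.α i = 0 ∧ Q.δ i = 0 ∧ Q.β i ≠ 0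
  · obtain ⟨i, h, h', h''⟩ := h1
    exact exists_isOptimal_of_linear hw₀ hm h h' h''
  by_cases h2 : ∃ i i', 0 < Q.α i ∧ Q.α i' < 0 ∧ Q.δ i / Q.α i = Q.δ i' / Q.α i'
  · obtain ⟨i, i', h, h', h''⟩ := h2
    exact exists_isOptimal_of_opposite hw₀ hm h h' h''
  push Not at h1 h2
  have hδ : ∀ i, Q.α i = 0 → 0 ≤ Q.δ i := fun i hi => delta_nonneg_of_forall_le hm hw₀ hi
  -- Positivity of `δ_i + μ α_i` means `μ > -δ_i / α_i` for `α_i > 0` and `μ < -δ_i / α_i` for `α_i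
  -- < 0`. Boundedness orders these finitely many bounds, and the excluded equality case makes the
  -- order strict.
  obtain ⟨μ, hlo, hhi⟩ := Order.exists_between_finsets
    ((Finset.univ.filter fun i => 0 < Q.α i).image fun i => -(Q.δ i / Q.α i))
    ((Finset.univ.filter fun i => Q.α i < 0).image fun i => -(Q.δ i / Q.α i)) (by
      simp only [Finset.mem_image, Finset.mem_filter, Finset.mem_univ, true_and]
      rintro _ ⟨i, hi, rfl⟩ _ ⟨i', hi', rfl⟩
      exact neg_lt_neg
        (lt_of_le_of_ne (div_le_div_of_opposite hw₀ hm hi hi') (h2 i i' hi hi').symm))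
  simp only [Finset.mem_image, Finset.mem_filter, Finset.mem_univ, true_and,
    forall_exists_index, and_imp, forall_apply_eq_imp_iff₂] at hlo hhi
  refine exists_isOptimal_of_coercive hw₀ hδ μ fun i => ?_
  have e : Q.α i ≠ 0 → Q.δ i + μ * Q.α i = (μ - -(Q.δ i / Q.α i)) * Q.α i := fun h => by
    field_simp
    ring
  rcases lt_trichotomy (Q.α i) 0 with h | h | h
  · left
    rw [e h.ne]
    exact mul_pos_of_neg_of_neg (sub_neg.2 (hhi i h)) h
  · rcases (hδ i h).eq_or_lt with h' | h'
    · exact .inr ⟨h, h1 i h h'.symm, h'.symm,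
        eta_eq_zero_of_forall_le hw₀ hm h h'.symm (h1 i h h'.symm)⟩
    · left
      rwa [h, mul_zero, add_zero]
  · left
    rw [e h.ne']
    exact mul_pos (sub_pos.2 (hlo i h)) h

end Existence

end GTRS

/-! ### The theorem -/

theorem theorem3p4 {n l k : ℕ} (P : GTRS.IP n) (hA : P.A.IsSymm) (hD : P.D.IsSymm)
    (hfeas : P.feasible.Nonempty) (hA0 : P.A ≠ 0)
    (S : Matrix (Fin n) (GTRS.Idx l k) ℝ) (p : Fin n → ℝ) (Q : GTRS.SOCP l k)
    (hcan : GTRS.IsCanonicalForm P S p Q) :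
    -- (IP) and (IP₁) have the same optimal value
    GTRS.optVal P.feasible P.obj = GTRS.optVal Q.feasible Q.obj ∧
    -- optimal solutions of (IP₁) can be made tight
    (∀ w, GTRS.IsOptimal Q.feasible Q.obj w →
      ∃ w', GTRS.IsOptimal Q.feasible Q.obj w' ∧ w'.Tight ∧ w'.z = w.z) ∧
    -- recovery of optimal or ε-optimal solutions of (IP) from tight optimal solutions of (IP₁)
    (∀ w, GTRS.IsOptimal Q.feasible Q.obj w → w.Tight →
      ((∀ j, ¬ Q.Critical w j) →
        ∀ M : ℝ, 0 < M → GTRS.IsOptimal P.feasible P.obj (S *ᵥ Q.recover M w + p)) ∧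
      (∀ ε : ℝ, 0 < ε → ∃ M₀ : ℝ, 0 < M₀ ∧ ∀ M : ℝ, M₀ ≤ M →
        GTRS.IsEpsOptimal P.feasible P.obj ε (S *ᵥ Q.recover M w + p) ∧
        (P.obj (S *ᵥ Q.recover M w + p) : EReal) <
          GTRS.optVal P.feasible P.obj + (ε : EReal))) ∧
    -- if (IP) is bounded from below: solvability of (IP₁), and unattainability criterion for (IP)
    (BddBelow (P.obj '' P.feasible) →
      (∃ w, GTRS.IsOptimal Q.feasible Q.obj w ∧ w.Tight) ∧
      ((¬ ∃ x, GTRS.IsOptimal P.feasible P.obj x) ↔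
        ∀ w, GTRS.IsOptimal Q.feasible Q.obj w → w.Tight → ∃ j, Q.Critical w j)) ∧
    -- distinct eigenvalues of 2 × 2 blocks make (IP) unbounded from below
    ((∃ i j, Q.ζ i ≠ Q.ζ j) → GTRS.optVal P.feasible P.obj = ⊥) := by
  have hval := hcan.optVal_eq hA hD hfeas hA0
  obtain ⟨w₀, hw₀, -⟩ := hcan.socp_feasible_nonempty hA hfeas
  refine ⟨hval, fun w hw => hw.exists_tight, fun w hw hwt => ⟨fun hcrit M hM => ?_, fun ε hε => ?_⟩,
    fun hbdd => ?_, fun ⟨i, j, hij⟩ => hval.trans (GTRS.socp_optVal_eq_bot hw₀ hij)⟩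
  · refine GTRS.isOptimal_of_le_optVal (hcan.recover_mem_feasible hA hM hwt hw.1) ?_
    rw [hcan.obj_recover_of_forall_not_critical hD hM hwt hcrit, hval, hw.optVal_eq]
  · obtain ⟨M₀, hM₀, h⟩ := hcan.exists_forall_obj_recover_lt hD hwt hε
    refine ⟨M₀, hM₀, fun M hM => ?_⟩
    have hlt : (P.obj (S *ᵥ Q.recover M w + p) : EReal) <
        GTRS.optVal P.feasible P.obj + (ε : EReal) := by
      rw [hval, hw.optVal_eq]
      exact_mod_cast h M hM
    exact ⟨⟨hcan.recover_mem_feasible hA (hM₀.trans_le hM) hwt hw.1, hlt.le⟩, hlt⟩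
  · obtain ⟨m, hm⟩ := hbdd
    have hm' : (m : EReal) ≤ GTRS.optVal P.feasible P.obj :=
      GTRS.le_optVal fun x hx => hm ⟨x, hx, rfl⟩
    obtain ⟨v, hv⟩ := GTRS.exists_isOptimal hw₀
      fun w hw => GTRS.le_of_le_optVal (hval ▸ hm') hw
    obtain ⟨w, hw, hwt, -⟩ := hv.exists_tight
    refine ⟨⟨w, hw, hwt⟩, fun hno w hw hwt => ?_, fun hcrit ⟨x, hx⟩ => ?_⟩
    · by_contra! hc
      refine hno ⟨_, GTRS.isOptimal_of_le_optVal
        (hcan.recover_mem_feasible hA one_pos hwt hw.1) ?_⟩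
      rw [hcan.obj_recover_of_forall_not_critical hD one_pos hwt hc, hval, hw.optVal_eq]
    · obtain ⟨u, rfl⟩ := hcan.exists_eq_affine x
      have hxval := hx.optVal_eq
      have hmem := (hcan.affine_mem_feasible_iff hA u).1 hx.1
      have hle : P.obj (S *ᵥ u + p) ≤ Q.obj (GTRS.lift u) := by
        have := GTRS.optVal_le (f := Q.obj) hmem
        rw [← hval, hxval] at this
        exact_mod_cast this
      have hopt : GTRS.IsOptimal Q.feasible Q.obj (GTRS.lift u) := by
        refine GTRS.isOptimal_of_le_optVal hmem ?_
        rw [← hval, hxval]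
        exact_mod_cast hcan.obj_lift_le hD u
      -- The lift of an optimal point of (IP) is optimal with zero remainder. At a critical block
      -- `θ_j = 0` then makes the second coordinate vanish, hence also the product `z_j`, a
      -- contradiction.
      obtain ⟨j, hθ, hz⟩ := hcrit _ hopt (GTRS.lift_tight u)
      rw [hcan.obj_affine hD] at hle
      have hterm := Finset.single_le_sum
        (f := fun j => 1 / 2 * (u (.inr (1, j)) + Q.θ j) ^ 2)
        (fun j _ => by positivity) (Finset.mem_univ j)
      have hsq : (u (.inr (1, j)) + Q.θ j) ^ 2 = 0 :=
        le_antisymm (by linarith) (sq_nonneg _)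
      have hzero : u (.inr (1, j)) = 0 := by
        simpa [hθ] using hsq
      exact hz (by simp [GTRS.lift, hzero])
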